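/- Let $\mathbb H$ be the real quaternions, $A\in\mathbb H^{n\times n}$ Hermitian ($A^*=A$) and $B\in\mathbb H^{n\times m}$. Write $\operatorname{rank}$ for the column rank (the largest number of right-linearly independent columns), let $k=\operatorname{Ind}A$ be the least integer $k\ge 0$ with $\operatorname{rank}A^{k+1}=\operatorname{rank}A^{k}$, and put $r=\operatorname{rank}A^{k+1}=\operatorname{rank}A^{k}$. The Drazin inverse $A^D$ is the unique $X\in\mathbb H^{n\times n}$ with $A^{k+1}X=A^k$, $XAX=X$ and $AX=XA$. For a square matrix $M=(m_{ab})$ over $\mathbb H$ with rows and columns indexed by a finite ordered set $\beta$, and for $i\in\beta$, the $i$-th column determinant is $$\operatorname{cdet}_i M=\sum_{\tau}(-1)^{|\beta|-c(\tau)}\,p_{c(\tau)}(\tau)\cdots p_2(\tau)\,p_1(\tau),$$ where $\tau$ runs over the permutations of $\beta$, $c(\tau)$ is the number of cycles of $\tau$ (fixed points included), and each $p_t(\tau)$ is the product $m_{x_0x_l}m_{x_lx_{l-1}}\cdots m_{x_2x_1}m_{x_1x_0}$ along a cycle $x_0\mapsto x_1\mapsto\cdots\mapsto x_l\mapsto x_0$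 of $\tau$ (equal to $m_{x_0x_0}$ if $x_0$ is fixed). Here $p_1$ belongs to the cycle of $i$, with $x_0=i$; the other cycles start at their least elements $x_0$, and these increase in the order $p_2,p_3,\dots$. If $M$ is Hermitian, all $\operatorname{cdet}_i M$ are equal, and their common value is denoted $|M|$ (with $|M|=1$ for the empty matrix). For a set $\beta\subseteq\{1,\dots,n\}$ let $M_\beta^\beta$ be the principal submatrix of $M$ with rows and columns in $\beta$, which keep their labels. Let $J_{r,n}$ be the collection of subsets of $\{1,\dots,n\}$ with $r$ elements, and $J_{r,n}\{i\}$ the collection of those that contain $i$. Let $M_{.i}(b)$ be $M$ with its $i$-th column replaced by $b$, and let $\hat b_{.j}$ be the $j$-th column of $\hat B=A^kB$. **Theorem 4.1.** The Drazin inverse $A^D$ exists and is unique, $\sum_{\beta\in J_{r,n}}\left|(A^{k+1})_\beta^\beta\right|\neq 0$, and the Drazin inverse solution $X=A^DB=(x_{ij})\in\mathbb H^{n\times m}$ of $AX=B$ is given, for all $1\le i\le n$ and $1\le j\le m$, by $$x_{ij}=\frac{\displaystyle\sum_{\beta\in J_{r,n}\{i\}}\operatorname{cdet}_i\left(\left((A^{k+1})_{.i}(\hat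 b_{.j})\right)_\beta^\beta\right)}{\displaystyle\sum_{\beta\in J_{r,n}}\left|(A^{k+1})_\beta^\beta\right|}.$$ -/

import Mathlib

open scoped Quaternion

namespace QuatMat

/-- The product of the entries of `A` along the cycle of `τ` that starts at `x`, written from right
to left: with `x₀ = x`, `x₁ = τ x`, ..., `x_l = τ^l x` the cycle of `x` (so `τ x_l = x`), it is
`A x x_l * A x_l x_(l-1) * ⋯ * A x₂ x₁ * A x₁ x`. A fixed point `x` contributes `A x x`. -/
noncomputable def cycleProd {ι R : Type*} [Ring R] (A : Matrix ι ι R) (τ : Equiv.Perm ι)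
    (x : ι) : R :=
  ((List.range (Function.minimalPeriod τ x)).reverse.map
    (fun s => A ((τ ^ (s + 1)) x) ((τ ^ s) x))).prod

open Classical in
/-- The least elements of the cycles of `τ` (fixed points included) that do not contain `j`. -/
noncomputable def otherLeaders {ι : Type*} [Fintype ι] [LinearOrder ι] (τ : Equiv.Perm ι)
    (j : ι) : Finset ι :=
  {x | ¬ τ.SameCycle j x ∧ ∀ y, τ.SameCycle x y → x ≤ y}

/-- The `j`-th column determinant. The term of `τ` is the product of its cycle products: the cycle
of `j`, started at `j`, stands rightmost; every other cycle is started at its least element, and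
these least elements increase from right to left. If `τ` has `r` cycles, counting fixed points, on
an `n`-element set, then `sign τ = (-1)^(n-r)`. -/
noncomputable def cdet {ι R : Type*} [Fintype ι] [LinearOrder ι] [Ring R] (A : Matrix ι ι R)
    (j : ι) : R :=
  ∑ τ : Equiv.Perm ι, ((Equiv.Perm.sign τ : ℤ) : R) *
    ((((otherLeaders τ j).sort (· ≥ ·)).map (cycleProd A τ)).prod * cycleProd A τ j)

open Classical in
/-- The determinant of a Hermitian matrix. All column determinants of a Hermitian quaternion matrix
are equal; we take the one at the least index. The determinant of the empty matrix is `1`. -/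
noncomputable def hermDet {ι R : Type*} [Fintype ι] [LinearOrder ι] [Ring R]
    (A : Matrix ι ι R) : R :=
  if h : (Finset.univ : Finset ι).Nonempty then cdet A (Finset.univ.min' h) else 1

/-- The principal submatrix of `A` with rows and columns in `β`, which keep their labels. -/
def principalSubmatrix {ι R : Type*} (A : Matrix ι ι R) (β : Finset ι) : Matrix β β R :=
  A.submatrix (fun x => (x : ι)) (fun x => (x : ι))

/-- The sum of the principal minors of order `r` of a (Hermitian) matrix. -/
noncomputable def sumPrincipalMinors {ι R : Type*} [Fintype ι] [LinearOrder ι] [Ring R] (r : ℕ)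
    (A : Matrix ι ι R) : R :=
  ∑ β : {β : Finset ι // β.card = r}, hermDet (principalSubmatrix A β.1)

/-- The sum, over the index sets `β` of order `r` that contain `i`, of the column determinants at
`i` of the principal submatrices of `A` with index set `β`. -/
noncomputable def sumPrincipalCdet {ι R : Type*} [Fintype ι] [LinearOrder ι] [Ring R] (r : ℕ)
    (A : Matrix ι ι R) (i : ι) : R :=
  ∑ β : {β : Finset ι // β.card = r ∧ i ∈ β}, cdet (principalSubmatrix A β.1) ⟨i, β.2.2⟩

/-- The column rank: the dimension of the right span of the columns, that is, the largest number of
right linearly independent columns. Right scalar multiplication is the action of `Rᵐᵒᵖ`. -/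
noncomputable def colRank {m n R : Type*} [Ring R] (A : Matrix m n R) : ℕ :=
  Module.finrank Rᵐᵒᵖ (Submodule.span Rᵐᵒᵖ (Set.range fun j : n => fun i : m => A i j))

/-- The index of a square matrix: the least `k ≥ 0` with `rank A^(k+1) = rank A^k`. -/
noncomputable def index {n R : Type*} [Fintype n] [DecidableEq n] [Ring R]
    (A : Matrix n n R) : ℕ :=
  sInf {k : ℕ | colRank (A ^ (k + 1)) = colRank (A ^ k)}

/-- `X` is a Drazin inverse of `A`. -/
structure IsDrazinInverse {n R : Type*} [Fintype n] [DecidableEq n] [Ring R]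
    (A X : Matrix n n R) : Prop where
  pow_succ_mul : A ^ (index A + 1) * X = A ^ index A
  mul_mul_self : X * A * X = X
  comm : A * X = X * A

end QuatMat

/-!
The proof rests on an adjugate for Hermitian quaternion matrices. In `cdet_i M` every term ends, on
the right, with an entry of the `i`-th column, so `cdet_i` of the principal submatrix on `β` is
`∑ l ∈ β, R_il * c_l` as a function of its `i`-th column `c`. Sorting the permutations by the image
`l` of `i` and cutting `l` out of the cycle of `i` shows that `R_ii` is the determinant on
`β \ {i}` and that, for `l ≠ i`, `-R_il` is `cdet_i` on `β \ {l}` with the `i`-th column replaced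
by the `l`-th one (`minorCdet_updateCol`). This recursion replaces all further work with
permutations.

For Hermitian `M` an induction on `β` gives: the determinant on `β` is real, `R` is Hermitian, and
`R * M` is the determinant times the identity on `β` (`cofactorRelations`). That the column
determinants `d_i` agree follows from `R * M = diag d = M * R`, which gives
`d_i * M_il = M_il * d_l`; if `M_il = 0`, that entry is perturbed and continuity is used.

Let `G_m` be the sum of the adjugates of order `m` (extended by zero) and `S_m` the sum of the
principal minors of order `m`. The recursion for `R` is just what is needed for
`G_(m+1) = S_m - G_m * M` (`adjSum_succ`); also `tr G_(m+1) = (n - m) S_m`. If `S_s` is the last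
nonzero `S_m`, then `G_(n+1) = 0` and `ker M ^ 2 = ker M` give `G_(s+1) * M = 0`. Hence
`Q = S_s⁻¹ G_s M` is idempotent with the column space of `M`, and its trace is `s`, so `s` is the
rank of `M`.

For `M = A ^ (k + 1)` of rank `r` it follows that `S_r⁻¹ G_r A ^ k` is the Drazin inverse of `A`,
and the entries of `G_r * (A ^ k * B)` are the numerators in the formula.
-/

open scoped Quaternion

namespace QuatMat

/-! ### Principal minors as sums over permutations of the whole index set -/

section Combinatorics

variable {ι κ R : Type*} [Ring R]

/-- A cycle product only depends on the orbit of the starting point and on the entries met along it;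
the map `e` covers passing from a principal submatrix to the whole matrix. -/
theorem cycleProd_congr {A : Matrix ι ι R} {B : Matrix κ κ R} {τ : Equiv.Perm ι}
    {σ : Equiv.Perm κ} {x : ι} {y : κ} (e : κ → ι) (he : Function.Injective e)
    (h : ∀ s : ℕ, e ((σ ^ s) y) = (τ ^ s) x)
    (hAB : ∀ s : ℕ, A ((τ ^ (s + 1)) x) ((τ ^ s) x) = B ((σ ^ (s + 1)) y) ((σ ^ s) y)) :
    cycleProd A τ x = cycleProd B σ y := by
  have hp : Function.minimalPeriod τ x = Function.minimalPeriod σ y := by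
    rw [Function.minimalPeriod_eq_minimalPeriod_iff]
    intro n
    have h0 := h 0
    simp only [pow_zero, Equiv.Perm.one_apply] at h0
    simp only [Function.IsPeriodicPt, Function.IsFixedPt, Equiv.Perm.iterate_eq_pow]
    rw [← h, ← h0, he.eq_iff]
  unfold cycleProd
  rw [hp]
  simp only [hAB]

theorem sameCycle_congr [Finite ι] [Finite κ] {τ : Equiv.Perm ι} {σ : Equiv.Perm κ} {x : ι} {y : κ}
    (e : κ → ι) (he : Function.Injective e) (h : ∀ s : ℕ, e ((σ ^ s) y) = (τ ^ s) x) (z : κ) :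
    τ.SameCycle x (e z) ↔ σ.SameCycle y z := by
  constructor
  · intro hz
    obtain ⟨s, hs⟩ := hz.exists_nat_pow_eq
    exact ⟨s, by rw [zpow_natCast]; exact he ((h s).trans hs)⟩
  · intro hz
    obtain ⟨s, hs⟩ := hz.exists_nat_pow_eq
    exact ⟨s, by rw [zpow_natCast, ← h, hs]⟩

theorem prod_map_sort_insert [LinearOrder ι] {s : Finset ι} {j : ι} (hj : ∀ x ∈ s, j < x)
    (f : ι → R) :
    (((insert j s).sort (· ≥ ·)).map f).prod = ((s.sort (· ≥ ·)).map f).prod * f j := by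
  have : (insert j s).sort (· ≥ ·) = s.sort (· ≥ ·) ++ [j] := by
    have hn : (s.sort (· ≥ ·) ++ [j]).Nodup := by
      refine List.Nodup.append (Finset.sort_nodup _ _) (List.nodup_singleton j) ?_
      intro a ha hb
      rw [List.mem_singleton] at hb
      rw [Finset.mem_sort] at ha
      exact (hj a ha).ne' hb
    have hs : insert j s = (s.sort (· ≥ ·) ++ [j]).toFinset := by
      ext x; simp
    rw [hs, List.toFinset_sort _ hn]
    rw [List.pairwise_append]
    refine ⟨Finset.pairwise_sort _ _, List.pairwise_singleton _ _, ?_⟩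
    intro a ha b hb
    rw [List.mem_singleton] at hb
    rw [Finset.mem_sort] at ha
    exact hb ▸ (hj a ha).le
  rw [this, List.map_append, List.prod_append]
  simp

variable [Fintype ι] [LinearOrder ι]

open Classical in
/-- The permutations of `β`, encoded as the permutations of `ι` that fix the complement of `β`. -/
noncomputable def permsOn (β : Finset ι) : Finset (Equiv.Perm ι) := {τ | ∀ x ∉ β, τ x = x}

theorem mem_permsOn {β : Finset ι} {τ : Equiv.Perm ι} : τ ∈ permsOn β ↔ ∀ x ∉ β, τ x = x := by
  simp [permsOn]

open Classical in
/-- The least elements of the cycles of `τ` contained in `β`. -/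
noncomputable def leadersIn (β : Finset ι) (τ : Equiv.Perm ι) : Finset ι :=
  {x ∈ β | ∀ y, τ.SameCycle x y → x ≤ y}

open Classical in
/-- The least elements of the cycles of `τ` contained in `β` and different from the cycle of `j`. -/
noncomputable def otherLeadersIn (β : Finset ι) (τ : Equiv.Perm ι) (j : ι) : Finset ι :=
  {x ∈ β | ¬ τ.SameCycle j x ∧ ∀ y, τ.SameCycle x y → x ≤ y}

/-- The determinant of the principal submatrix of `A` on `β`, as a sum over permutations of the
whole index set; all cycle products are ordered by the least elements of the cycles. -/
noncomputable def minorDet (β : Finset ι) (A : Matrix ι ι R) : R :=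
  ∑ τ ∈ permsOn β, ((Equiv.Perm.sign τ : ℤ) : R) *
    (((leadersIn β τ).sort (· ≥ ·)).map (cycleProd A τ)).prod

/-- The `j`-th column determinant of the principal submatrix of `A` on `β`, as a sum over
permutations of the whole index set. -/
noncomputable def minorCdet (β : Finset ι) (A : Matrix ι ι R) (j : ι) : R :=
  ∑ τ ∈ permsOn β, ((Equiv.Perm.sign τ : ℤ) : R) *
    ((((otherLeadersIn β τ j).sort (· ≥ ·)).map (cycleProd A τ)).prod * cycleProd A τ j)

theorem leadersIn_eq_insert {β : Finset ι} {τ : Equiv.Perm ι} (hτ : τ ∈ permsOn β) {j : ι}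
    (hj : j ∈ β) (hmin : ∀ x ∈ β, j ≤ x) : leadersIn β τ = insert j (otherLeadersIn β τ j) := by
  rw [mem_permsOn] at hτ
  ext x
  simp only [leadersIn, otherLeadersIn, Finset.mem_insert, Finset.mem_filter]
  constructor
  · rintro ⟨hx, h⟩
    by_cases hs : τ.SameCycle j x
    · exact Or.inl (le_antisymm (h j hs.symm) (hmin x hx))
    · exact Or.inr ⟨hx, hs, h⟩
  · rintro (rfl | ⟨hx, -, h⟩)
    · refine ⟨hj, fun y hy => ?_⟩
      by_cases hyβ : y ∈ β
      · exact hmin y hyβ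
      · exact (hy.eq_of_right (hτ y hyβ)).le
    · exact ⟨hx, h⟩

theorem minorDet_eq_minorCdet {β : Finset ι} (A : Matrix ι ι R) {j : ι} (hj : j ∈ β)
    (hmin : ∀ x ∈ β, j ≤ x) : minorDet β A = minorCdet β A j := by
  refine Finset.sum_congr rfl fun τ hτ => ?_
  rw [leadersIn_eq_insert hτ hj hmin, prod_map_sort_insert]
  intro x hx
  simp only [otherLeadersIn, Finset.mem_filter] at hx
  refine lt_of_le_of_ne (hmin x hx.1) ?_
  rintro rfl
  exact hx.2.1 (Equiv.Perm.SameCycle.refl _ _)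

theorem permsOn_empty : permsOn (∅ : Finset ι) = {1} := by
  ext τ
  rw [mem_permsOn, Finset.mem_singleton]
  constructor
  · intro h; ext x; simp [h]
  · rintro rfl; simp

@[simp]
theorem minorDet_empty (A : Matrix ι ι R) : minorDet ∅ A = 1 := by
  simp [minorDet, permsOn_empty, leadersIn]

theorem cdet_principalSubmatrix (A : Matrix ι ι R) (β : Finset ι) (j : β) :
    cdet (principalSubmatrix A β) j = minorCdet β A j := by
  classical
  unfold cdet minorCdet
  have hpow : ∀ (σ : Equiv.Perm β) (x : β) (s : ℕ),
      (((σ ^ s) x : β) : ι) = ((Equiv.Perm.ofSubtype σ) ^ s) (x : ι) := by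
    intro σ x s
    rw [← map_pow, Equiv.Perm.ofSubtype_apply_coe]
  have hcyc : ∀ (σ : Equiv.Perm β) (x : β),
      cycleProd (principalSubmatrix A β) σ x = cycleProd A (Equiv.Perm.ofSubtype σ) (x : ι) := by
    intro σ x
    refine (cycleProd_congr Subtype.val Subtype.val_injective (hpow σ x) fun s => ?_).symm
    rw [← hpow, ← hpow]
    rfl
  refine Finset.sum_nbij (fun σ => Equiv.Perm.ofSubtype σ) ?_ ?_ ?_ ?_
  · intro σ _
    rw [mem_permsOn]
    intro x hx
    exact Equiv.Perm.ofSubtype_apply_of_not_mem σ hx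
  · exact fun σ _ σ' _ h => Equiv.Perm.ofSubtype_injective h
  · intro τ hτ
    have hτ' : ∀ x ∉ β, τ x = x := mem_permsOn.1 hτ
    have h2 : ∀ x, τ x ≠ x → x ∈ β := fun x hx => by
      by_contra hxβ
      exact hx (hτ' x hxβ)
    have h1 : ∀ x, τ x ∈ β ↔ x ∈ β := by
      intro x
      by_cases hx : τ x = x
      · rw [hx]
      · exact iff_of_true (h2 _ fun h => hx (τ.injective h)) (h2 x hx)
    exact ⟨τ.subtypePerm h1, Finset.mem_coe.2 (Finset.mem_univ _),
      Equiv.Perm.ofSubtype_subtypePerm h1 h2⟩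
  · intro σ _
    rw [Equiv.Perm.sign_ofSubtype, hcyc]
    congr 2
    have hL : (otherLeaders σ j).map (Function.Embedding.subtype _) =
        otherLeadersIn β (Equiv.Perm.ofSubtype σ) j := by
      have hsc : ∀ x y : β, (Equiv.Perm.ofSubtype σ).SameCycle (x : ι) y ↔ σ.SameCycle x y :=
        fun x y => sameCycle_congr Subtype.val Subtype.val_injective (hpow σ x) y
      ext x
      simp only [otherLeaders, otherLeadersIn, Finset.mem_map, Finset.mem_filter,
        Finset.mem_univ, true_and, Function.Embedding.subtype_apply]
      constructor
      · rintro ⟨x, ⟨h1, h2⟩, rfl⟩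
        refine ⟨x.2, by rwa [hsc], fun y hy => ?_⟩
        by_cases hyβ : y ∈ β
        · exact h2 ⟨y, hyβ⟩ ((hsc x ⟨y, hyβ⟩).1 hy)
        · exact (hy.eq_of_right (Equiv.Perm.ofSubtype_apply_of_not_mem σ hyβ)).le
      · rintro ⟨hx, h1, h2⟩
        refine ⟨⟨x, hx⟩, ⟨by rwa [← hsc], fun y hy => ?_⟩, rfl⟩
        exact h2 y ((hsc ⟨x, hx⟩ y).2 hy)
    rw [← hL, ← Finset.map_sort (Function.Embedding.subtype _) _ (· ≥ ·) (· ≥ ·)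
      (fun a _ b _ => Iff.rfl), List.map_map]
    congr 1
    refine List.map_congr_left fun x _ => ?_
    exact hcyc σ x

theorem hermDet_principalSubmatrix (A : Matrix ι ι R) (β : Finset ι) :
    hermDet (principalSubmatrix A β) = minorDet β A := by
  unfold hermDet
  split_ifs with h
  · rw [cdet_principalSubmatrix, minorDet_eq_minorCdet A (Subtype.coe_prop _)]
    intro x hx
    exact Finset.min'_le (Finset.univ : Finset β) ⟨x, hx⟩ (Finset.mem_univ _)
  · have : β = ∅ := by
      rw [Finset.eq_empty_iff_forall_notMem]
      exact fun x hx => h ⟨⟨x, hx⟩, Finset.mem_univ _⟩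
    subst this
    simp

end Combinatorics

/-! ### Expansion of a column determinant along its column -/

section FirstStep

theorem pow_mul_swap_of_not_sameCycle {ι : Type*} [DecidableEq ι] {τ : Equiv.Perm ι} {i x : ι}
    (hx : ¬ τ.SameCycle i x) (s : ℕ) : ((τ * Equiv.swap i (τ i)) ^ s) x = (τ ^ s) x := by
  induction s with
  | zero => rfl
  | succ s ih =>
    rw [pow_succ', pow_succ', Equiv.Perm.mul_apply, ih, Equiv.Perm.mul_apply, Equiv.Perm.mul_apply,
      Equiv.swap_apply_of_ne_of_ne]
    · intro h
      exact hx (h ▸ Equiv.Perm.sameCycle_pow_right.2 (Equiv.Perm.SameCycle.refl τ x)).symm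
    · intro h
      have h' : τ.SameCycle x (τ i) :=
        h ▸ Equiv.Perm.sameCycle_pow_right.2 (Equiv.Perm.SameCycle.refl τ x)
      exact hx (Equiv.Perm.sameCycle_apply_right.1 h').symm

theorem pow_ne_pow_of_lt_minimalPeriod {ι : Type*} {τ : Equiv.Perm ι} {i : ι} {s t : ℕ}
    (hst : s ≠ t) (hs : s < Function.minimalPeriod τ i) (ht : t < Function.minimalPeriod τ i) :
    (τ ^ s) i ≠ (τ ^ t) i := by
  rw [← Equiv.Perm.iterate_eq_pow, ← Equiv.Perm.iterate_eq_pow]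
  intro h
  exact hst ((Function.iterate_eq_iterate_iff_of_lt_minimalPeriod hs ht).1 h)

theorem pow_minimalPeriod {ι : Type*} (τ : Equiv.Perm ι) (i : ι) :
    (τ ^ Function.minimalPeriod τ i) i = i := by
  rw [← Equiv.Perm.iterate_eq_pow, Function.iterate_minimalPeriod]

/-- Along the shortened cycle of `i`, every step after the first is the step of `τ` one place
further. -/
theorem pow_succ_mul_swap {ι : Type*} [DecidableEq ι] {τ : Equiv.Perm ι} {i : ι} (s : ℕ)
    (hs : s + 1 < Function.minimalPeriod τ i) :
    ((τ * Equiv.swap i (τ i)) ^ (s + 1)) i = (τ ^ (s + 2)) i := by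
  induction s with
  | zero => simp [pow_two]
  | succ s ih =>
    rw [pow_succ', Equiv.Perm.mul_apply, ih (by omega), Equiv.Perm.mul_apply,
      Equiv.swap_apply_of_ne_of_ne, ← Equiv.Perm.mul_apply, ← pow_succ']
    · exact pow_ne_pow_of_lt_minimalPeriod (t := 0) (by omega) (by omega) (by omega)
    · simpa using pow_ne_pow_of_lt_minimalPeriod (τ := τ) (i := i) (s := s + 2) (t := 1)
        (by omega) (by omega) (by omega)

theorem one_lt_minimalPeriod {ι : Type*} [Finite ι] {τ : Equiv.Perm ι} {i : ι} (h : τ i ≠ i) :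
    1 < Function.minimalPeriod τ i := by
  have h0 : 0 < Function.minimalPeriod τ i :=
    Function.IsPeriodicPt.minimalPeriod_pos (n := orderOf τ) (orderOf_pos τ) (by
      simp [Function.IsPeriodicPt, Function.IsFixedPt, Equiv.Perm.iterate_eq_pow,
        pow_orderOf_eq_one])
  have h1 : Function.minimalPeriod τ i ≠ 1 := fun h' =>
    h (Function.minimalPeriod_eq_one_iff_isFixedPt.1 h')
  omega

theorem minimalPeriod_mul_swap {ι : Type*} [Finite ι] [DecidableEq ι] {τ : Equiv.Perm ι} {i : ι}
    (h : τ i ≠ i) : Function.minimalPeriod τ i =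
      Function.minimalPeriod (τ * Equiv.swap i (τ i)) i + 1 := by
  have h1 := one_lt_minimalPeriod h
  obtain ⟨q, hq⟩ : ∃ q, Function.minimalPeriod τ i = q + 2 := ⟨_, (Nat.sub_add_cancel h1).symm⟩
  have hper : ((τ * Equiv.swap i (τ i)) ^ (q + 1)) i = i := by
    rw [pow_succ_mul_swap q (by omega), ← hq, pow_minimalPeriod]
  suffices Function.minimalPeriod (τ * Equiv.swap i (τ i)) i = q + 1 by omega
  refine le_antisymm (Function.IsPeriodicPt.minimalPeriod_le (by omega) ?_) ?_
  · rw [Function.IsPeriodicPt, Function.IsFixedPt, Equiv.Perm.iterate_eq_pow]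
    exact hper
  · by_contra hlt
    have hpos : 0 < Function.minimalPeriod (τ * Equiv.swap i (τ i)) i :=
      Function.IsPeriodicPt.minimalPeriod_pos (n := q + 1) (by omega) (by
        rw [Function.IsPeriodicPt, Function.IsFixedPt, Equiv.Perm.iterate_eq_pow]
        exact hper)
    obtain ⟨t, ht⟩ := Nat.exists_eq_add_of_lt hpos
    have hp := pow_minimalPeriod (τ * Equiv.swap i (τ i)) i
    rw [ht, zero_add, pow_succ_mul_swap t (by omega)] at hp
    exact pow_ne_pow_of_lt_minimalPeriod (τ := τ) (i := i) (s := t + 2) (t := 0) (by omega)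
      (by omega) (by omega) hp

/-- The permutation `τ * swap i (τ i)` arises from `τ` by removing the point `τ i` from the cycle of
`i`. -/
theorem sameCycle_mul_swap_iff {ι : Type*} [Finite ι] [DecidableEq ι] {τ : Equiv.Perm ι} {i : ι}
    (h : τ i ≠ i) (y : ι) :
    (τ * Equiv.swap i (τ i)).SameCycle i y ↔ τ.SameCycle i y ∧ y ≠ τ i := by
  constructor
  · intro hy
    refine ⟨?_, ?_⟩
    · by_contra hn
      exact hn ((sameCycle_congr id Function.injective_id
        (pow_mul_swap_of_not_sameCycle hn) i).2 hy.symm).symm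
    · rintro rfl
      exact h (hy.eq_of_right (by simp [Function.IsFixedPt])).symm
  · rintro ⟨hy, hne⟩
    obtain ⟨s, hs⟩ := hy.exists_nat_pow_eq
    have hmod : (τ ^ (s % Function.minimalPeriod τ i)) i = y := by
      rw [← hs, ← Equiv.Perm.iterate_eq_pow, ← Equiv.Perm.iterate_eq_pow,
        Function.iterate_mod_minimalPeriod_eq]
    have hlt := Nat.mod_lt s (lt_trans one_pos (one_lt_minimalPeriod h))
    generalize s % Function.minimalPeriod τ i = t at hmod hlt
    match t, hmod, hlt with
    | 0, hmod, _ => exact hmod ▸ Equiv.Perm.SameCycle.refl _ _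
    | 1, hmod, _ => exact absurd hmod.symm (by simpa using hne)
    | t + 2, hmod, hlt =>
      rw [← pow_succ_mul_swap t (by omega)] at hmod
      exact ⟨(t + 1 : ℕ), by rw [zpow_natCast]; exact hmod⟩

variable {ι R : Type*} [Ring R]

/-- The first step of the shortened cycle leads from `i` to `τ (τ i)`, with the entry of `A` in
column `τ i`; this is why the `i`-th column is replaced by that one. -/
theorem cycleProd_updateCol_mul_swap [Finite ι] [DecidableEq ι] (A : Matrix ι ι R)
    {τ : Equiv.Perm ι} {i : ι} (c : ι → R) (h : τ i ≠ i) :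
    cycleProd (A.updateCol i c) τ i =
      cycleProd (A.updateCol i (A.col (τ i))) (τ * Equiv.swap i (τ i)) i * c (τ i) := by
  have hp := minimalPeriod_mul_swap h
  unfold cycleProd
  rw [hp, List.range_succ_eq_map, List.reverse_cons, List.map_append, List.prod_append,
    ← List.map_reverse, List.map_map]
  congr 1
  · congr 1
    refine List.map_congr_left fun s hs => ?_
    rw [List.mem_reverse, List.mem_range] at hs
    have h1 : (τ ^ (s + 1)) i ≠ i :=
      pow_ne_pow_of_lt_minimalPeriod (t := 0) (by omega) (by omega) (by omega)
    rw [Function.comp_apply, Nat.succ_eq_add_one, Matrix.updateCol_ne h1]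
    rcases s with _ | s
    · simp [pow_two, Matrix.col]
    · have h2 : (τ ^ (s + 2)) i ≠ i := h1
      rw [pow_succ_mul_swap s (by omega), Matrix.updateCol_ne h2]
      congr 1
      by_cases hlast : s + 2 < Function.minimalPeriod τ i
      · rw [pow_succ_mul_swap (s + 1) (by omega)]
      · have e1 : s + 1 + 1 = Function.minimalPeriod (τ * Equiv.swap i (τ i)) i := by omega
        rw [e1, pow_minimalPeriod, ← hp, pow_minimalPeriod]
  · simp

variable [Fintype ι] [LinearOrder ι]

theorem otherLeadersIn_mul_swap {β : Finset ι} {τ : Equiv.Perm ι} {i : ι} (h : τ i ≠ i) :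
    otherLeadersIn (β.erase (τ i)) (τ * Equiv.swap i (τ i)) i = otherLeadersIn β τ i := by
  ext x
  simp only [otherLeadersIn, Finset.mem_filter, Finset.mem_erase]
  have key : ¬ τ.SameCycle i x → ∀ y, (τ * Equiv.swap i (τ i)).SameCycle x y ↔ τ.SameCycle x y :=
    fun hx y => (sameCycle_congr id Function.injective_id
      (fun s => (pow_mul_swap_of_not_sameCycle hx s).symm) y)
  constructor
  · rintro ⟨⟨h1, h2⟩, h3, h4⟩
    have hx : ¬ τ.SameCycle i x := fun hx => h3 ((sameCycle_mul_swap_iff h x).2 ⟨hx, h1⟩)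
    exact ⟨h2, hx, fun y hy => h4 y ((key hx y).2 hy)⟩
  · rintro ⟨h2, hx, h4⟩
    refine ⟨⟨?_, h2⟩, fun h' => hx ((sameCycle_mul_swap_iff h x).1 h').1,
      fun y hy => h4 y ((key hx y).1 hy)⟩
    rintro rfl
    exact hx (Equiv.Perm.sameCycle_apply_right.2 (Equiv.Perm.SameCycle.refl _ _))

theorem prod_otherLeadersIn_congr {β : Finset ι} {τ σ : Equiv.Perm ι} {i : ι} {A B : Matrix ι ι R}
    (hσ : ∀ x, ¬ τ.SameCycle i x → ∀ s : ℕ, (σ ^ s) x = (τ ^ s) x)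
    (hAB : ∀ x y, y ≠ i → A x y = B x y) :
    (((otherLeadersIn β τ i).sort (· ≥ ·)).map (cycleProd A τ)).prod =
      (((otherLeadersIn β τ i).sort (· ≥ ·)).map (cycleProd B σ)).prod := by
  congr 1
  refine List.map_congr_left fun x hx => ?_
  rw [Finset.mem_sort] at hx
  simp only [otherLeadersIn, Finset.mem_filter] at hx
  refine cycleProd_congr id Function.injective_id (hσ x hx.2.1) fun s => ?_
  rw [hσ x hx.2.1, hσ x hx.2.1]
  refine hAB _ _ fun h => hx.2.1 ?_
  exact (h ▸ Equiv.Perm.sameCycle_pow_right.2 (Equiv.Perm.SameCycle.refl τ x)).symm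

/-- The coefficients of the column determinant at `i` as a function of the `i`-th column; for a
Hermitian matrix they form the adjugate of the principal submatrix on `β`. -/
noncomputable def minorAdj (A : Matrix ι ι R) (β : Finset ι) (i l : ι) : R :=
  if l = i then minorDet (β.erase i) A
  else - minorCdet (β.erase l) (A.updateCol i (A.col l)) i

/-- Expansion of a column determinant along its column: the term of a permutation is sorted by the
image `l` of `i`, and `l` is then removed from the cycle of `i`. -/
theorem minorCdet_updateCol (A : Matrix ι ι R) {β : Finset ι} {i : ι} (hi : i ∈ β) (c : ι → R) :
    minorCdet β (A.updateCol i c) i = ∑ l ∈ β, minorAdj A β i l * c l := by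
  have hmaps : ∀ τ ∈ permsOn β, τ i ∈ β := by
    intro τ hτ
    rw [mem_permsOn] at hτ
    by_contra h
    exact h ((τ.injective (hτ _ h)).symm ▸ hi)
  unfold minorCdet
  rw [← Finset.sum_fiberwise_of_maps_to hmaps]
  refine Finset.sum_congr rfl fun l hl => ?_
  unfold minorAdj
  split_ifs with hli
  · subst hli
    have hset : {τ ∈ permsOn β | τ l = l} = permsOn (β.erase l) := by
      ext τ
      simp only [Finset.mem_filter, mem_permsOn, Finset.mem_erase]
      constructor
      · rintro ⟨h1, h2⟩ x hx
        by_cases hxl : x = l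
        · rw [hxl, h2]
        · exact h1 x fun h => hx ⟨hxl, h⟩
      · exact fun h => ⟨fun x hx => h x fun h' => hx h'.2, h l fun h' => h'.1 rfl⟩
    rw [hset, minorDet, Finset.sum_mul]
    refine Finset.sum_congr rfl fun τ hτ => ?_
    have hfix : τ l = l := mem_permsOn.1 hτ l (Finset.notMem_erase l β)
    rw [mul_assoc]
    congr 1
    rw [prod_otherLeadersIn_congr (σ := τ) (B := A) (fun _ _ _ => rfl)
      (fun x y hy => Matrix.updateCol_ne hy)]
    congr 1
    · have : otherLeadersIn β τ l = leadersIn (β.erase l) τ := by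
        ext x
        simp only [otherLeadersIn, leadersIn, Finset.mem_filter, Finset.mem_erase]
        constructor
        · rintro ⟨h1, h2, h3⟩
          exact ⟨⟨fun h => h2 (h ▸ Equiv.Perm.SameCycle.refl _ _), h1⟩, h3⟩
        · rintro ⟨⟨h1, h2⟩, h3⟩
          exact ⟨h2, fun h => h1 (h.eq_of_left hfix).symm, h3⟩
      rw [this]
    · have : Function.minimalPeriod τ l = 1 := Function.minimalPeriod_eq_one_iff_isFixedPt.2 hfix
      simp [cycleProd, this, hfix]
  · rw [minorCdet, neg_mul, Finset.sum_mul, ← Finset.sum_neg_distrib]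
    have hfl : ∀ τ ∈ ({τ ∈ permsOn β | τ i = l} : Finset _), τ i = l :=
      fun τ hτ => (Finset.mem_filter.1 hτ).2
    refine Finset.sum_bij' (fun τ _ => τ * Equiv.swap i l) (fun τ _ => τ * Equiv.swap i l)
      ?_ ?_ ?_ ?_ ?_
    · intro τ hτ
      have h := hfl τ hτ
      have hτ := mem_permsOn.1 (Finset.mem_filter.1 hτ).1
      rw [mem_permsOn]
      intro x hx
      by_cases hxl : x = l
      · simp [hxl, h]
      · have hxβ : x ∉ β := fun h' => hx (Finset.mem_erase.2 ⟨hxl, h'⟩)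
        rw [Equiv.Perm.mul_apply, Equiv.swap_apply_of_ne_of_ne (by rintro rfl; exact hxβ hi) hxl]
        exact hτ x hxβ
    · intro τ hτ
      have hτ := mem_permsOn.1 hτ
      refine Finset.mem_filter.2 ⟨mem_permsOn.2 fun x hx => ?_, ?_⟩
      · rw [Equiv.Perm.mul_apply, Equiv.swap_apply_of_ne_of_ne (by rintro rfl; exact hx hi)
          (by rintro rfl; exact hx hl)]
        exact hτ x fun h => hx (Finset.mem_of_mem_erase h)
      · simpa using hτ l (Finset.notMem_erase l β)
    · intro τ _
      simp [mul_assoc]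
    · intro τ _
      simp [mul_assoc]
    · intro τ hτ
      obtain rfl := hfl τ hτ
      rw [otherLeadersIn_mul_swap hli, cycleProd_updateCol_mul_swap A c hli,
        prod_otherLeadersIn_congr (σ := τ * Equiv.swap i (τ i)) (B := A.updateCol i (A.col (τ i)))
          (fun x hx => pow_mul_swap_of_not_sameCycle hx)
          (fun x y hy => by rw [Matrix.updateCol_ne hy, Matrix.updateCol_ne hy]),
        Equiv.Perm.sign_mul, Equiv.Perm.sign_swap (Ne.symm hli)]
      simp [mul_assoc]

end FirstStep

/-! ### Cofactor relations for Hermitian matrices -/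

section Hermitian

theorem mul_comm_of_star_eq_self {a : ℍ[ℝ]} (ha : star a = a) (b : ℍ[ℝ]) : a * b = b * a := by
  rw [Quaternion.star_eq_self.1 ha]
  exact Quaternion.coe_commutes _ _

variable {ι : Type*} [Fintype ι] [LinearOrder ι]

theorem minorCdet_eq_sum {R : Type*} [Ring R] (M : Matrix ι ι R) {β : Finset ι} {i : ι}
    (hi : i ∈ β) : minorCdet β M i = ∑ l ∈ β, minorAdj M β i l * M l i := by
  have h := minorCdet_updateCol M hi (fun l => M l i)
  have e : M.updateCol i (fun l => M l i) = M := Matrix.updateCol_eq_self M i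
  rwa [e] at h

theorem minorAdj_self {R : Type*} [Ring R] (M : Matrix ι ι R) (β : Finset ι) (i : ι) :
    minorAdj M β i i = minorDet (β.erase i) M := by
  simp [minorAdj]

theorem minorAdj_of_ne {R : Type*} [Ring R] (M : Matrix ι ι R) {β : Finset ι} {i l : ι}
    (hi : i ∈ β) (hil : i ≠ l) :
    minorAdj M β i l = -∑ y ∈ β.erase l, minorAdj M (β.erase l) i y * M y l := by
  rw [minorAdj, if_neg hil.symm, minorCdet_updateCol M (Finset.mem_erase.2 ⟨hil, hi⟩)]
  rfl

/-- The cofactor relations of the principal submatrix of `M` on `β`: the determinant is real, the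
adjugate is Hermitian, and the adjugate times the submatrix is the determinant times the identity
matrix. -/
structure CofactorRelations (M : Matrix ι ι ℍ[ℝ]) (β : Finset ι) : Prop where
  star_det : star (minorDet β M) = minorDet β M
  star_adj : ∀ i ∈ β, ∀ l ∈ β, star (minorAdj M β i l) = minorAdj M β l i
  adj_mul : ∀ i ∈ β, ∀ j ∈ β,
    ∑ l ∈ β, minorAdj M β i l * M l j = if i = j then minorDet β M else 0

variable {M : Matrix ι ι ℍ[ℝ]} {β : Finset ι}

theorem CofactorRelations.mul_adj (h : CofactorRelations M β) (hM : M.IsHermitian) {i j : ι}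
    (hi : i ∈ β) (hj : j ∈ β) :
    ∑ l ∈ β, M i l * minorAdj M β l j = if i = j then minorDet β M else 0 := by
  have := congrArg star (h.adj_mul j hj i hi)
  rw [star_sum] at this
  have e : star (if j = i then minorDet β M else 0) = if i = j then minorDet β M else 0 := by
    simp only [eq_comm (a := j)]
    split_ifs
    · exact h.star_det
    · exact star_zero _
  rw [← e, ← this]
  refine Finset.sum_congr rfl fun l hl => ?_
  rw [star_mul, hM.apply, h.star_adj j hj l hl]

/-- An off-diagonal adjugate entry with the recursion applied at both ends. The right-hand side is
visibly conjugated when `i` and `l` are exchanged. -/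
theorem minorAdj_eq_of_erase (hM : M.IsHermitian) (IH : ∀ γ ⊂ β, CofactorRelations M γ)
    {i l : ι} (hi : i ∈ β) (hl : l ∈ β) (hil : i ≠ l) :
    minorAdj M β i l = ∑ y ∈ (β.erase l).erase i, ∑ z ∈ (β.erase l).erase i,
      M i z * minorAdj M ((β.erase l).erase i) z y * M y l
      - minorDet ((β.erase l).erase i) M * M i l := by
  have hil' : i ∈ β.erase l := Finset.mem_erase.2 ⟨hil, hi⟩
  have h1 := IH _ (Finset.erase_ssubset hl)
  have h2 := IH _ ((Finset.erase_ssubset hil').trans (Finset.erase_ssubset hl))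
  rw [minorAdj_of_ne M hi hil, ← Finset.add_sum_erase _ _ hil', minorAdj_self, neg_add_rev,
    ← sub_eq_add_neg, ← Finset.sum_neg_distrib]
  congr 1
  refine Finset.sum_congr rfl fun y hy => ?_
  have hy' := Finset.mem_erase.1 hy
  rw [← h1.star_adj y hy'.2 i hil', minorAdj_of_ne M hy'.2 hy'.1, star_neg, star_sum, neg_mul,
    neg_neg, Finset.sum_mul]
  refine Finset.sum_congr rfl fun z hz => ?_
  rw [star_mul, hM.apply, h2.star_adj y hy z hz]

theorem star_minorAdj_of_erase (hM : M.IsHermitian) (IH : ∀ γ ⊂ β, CofactorRelations M γ)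
    {i l : ι} (hi : i ∈ β) (hl : l ∈ β) : star (minorAdj M β i l) = minorAdj M β l i := by
  by_cases hil : i = l
  · subst hil
    rw [minorAdj_self]
    exact (IH _ (Finset.erase_ssubset hl)).star_det
  · have hil' : i ∈ β.erase l := Finset.mem_erase.2 ⟨hil, hi⟩
    have h2 := IH _ ((Finset.erase_ssubset hil').trans (Finset.erase_ssubset hl))
    rw [minorAdj_eq_of_erase hM IH hi hl hil, minorAdj_eq_of_erase hM IH hl hi (Ne.symm hil),
      Finset.erase_right_comm (a := i) (b := l), star_sub, star_mul, hM.apply, h2.star_det,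
      mul_comm_of_star_eq_self h2.star_det, star_sum, Finset.sum_comm]
    congr 1
    refine Finset.sum_congr rfl fun y hy => ?_
    rw [star_sum]
    refine Finset.sum_congr rfl fun z hz => ?_
    rw [star_mul, star_mul, hM.apply, hM.apply, h2.star_adj z hz y hy, mul_assoc]

theorem mul_minorAdj_of_erase (hM : M.IsHermitian) (IH : ∀ γ ⊂ β, CofactorRelations M γ)
    {j l : ι} (hj : j ∈ β) (hl : l ∈ β) (hjl : j ≠ l) :
    ∑ i ∈ β, M j i * minorAdj M β i l = 0 := by
  have h1 := IH _ (Finset.erase_ssubset hl)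
  have hjl' : j ∈ β.erase l := Finset.mem_erase.2 ⟨hjl, hj⟩
  have e : ∑ i ∈ β.erase l, M j i * minorAdj M β i l = - (minorDet (β.erase l) M * M j l) := by
    calc ∑ i ∈ β.erase l, M j i * minorAdj M β i l
        = ∑ i ∈ β.erase l, ∑ y ∈ β.erase l, - (M j i * minorAdj M (β.erase l) i y * M y l) := by
          refine Finset.sum_congr rfl fun i hi => ?_
          rw [Finset.mem_erase] at hi
          rw [minorAdj_of_ne M hi.2 hi.1, mul_neg, Finset.mul_sum, Finset.sum_neg_distrib]
          simp only [mul_assoc]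
      _ = - ∑ y ∈ β.erase l, (∑ i ∈ β.erase l, M j i * minorAdj M (β.erase l) i y) * M y l := by
          rw [Finset.sum_comm]
          simp only [Finset.sum_neg_distrib, Finset.sum_mul]
      _ = - ∑ y ∈ β.erase l, (if j = y then minorDet (β.erase l) M else 0) * M y l := by
          congr 1
          refine Finset.sum_congr rfl fun y hy => ?_
          rw [h1.mul_adj hM hjl' hy]
      _ = _ := by simp [ite_mul, hj, hjl]
  rw [← Finset.add_sum_erase _ _ hl, e, minorAdj_self, mul_comm_of_star_eq_self h1.star_det]
  exact add_neg_cancel _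

theorem minorAdj_mul_of_erase (hM : M.IsHermitian) (IH : ∀ γ ⊂ β, CofactorRelations M γ)
    {i j : ι} (hi : i ∈ β) (hj : j ∈ β) (hij : i ≠ j) :
    ∑ l ∈ β, minorAdj M β i l * M l j = 0 := by
  have := congrArg star (mul_minorAdj_of_erase hM IH hj hi (Ne.symm hij))
  rw [star_sum, star_zero] at this
  rw [← this]
  refine Finset.sum_congr rfl fun l hl => ?_
  rw [star_mul, hM.apply, star_minorAdj_of_erase hM IH hl hi]

theorem star_minorCdet_of_erase (hM : M.IsHermitian) (IH : ∀ γ ⊂ β, CofactorRelations M γ)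
    {i : ι} (hi : i ∈ β) : star (minorCdet β M i) = minorCdet β M i := by
  have h1 := IH _ (Finset.erase_ssubset hi)
  have e : minorCdet β M i = minorDet (β.erase i) M * M i i -
      ∑ l ∈ β.erase i, ∑ y ∈ β.erase i, M i y * minorAdj M (β.erase i) y l * M l i := by
    rw [minorCdet_eq_sum M hi, ← Finset.add_sum_erase _ _ hi, minorAdj_self, sub_eq_add_neg,
      ← Finset.sum_neg_distrib]
    congr 1
    refine Finset.sum_congr rfl fun l hl => ?_
    have hl' := Finset.mem_erase.1 hl
    rw [← star_minorAdj_of_erase hM IH hl'.2 hi, minorAdj_of_ne M hl'.2 hl'.1, star_neg, star_sum,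
      neg_mul, Finset.sum_mul]
    congr 1
    refine Finset.sum_congr rfl fun y hy => ?_
    rw [star_mul, hM.apply, h1.star_adj l hl y hy]
  rw [e, star_sub, star_mul, hM.apply, h1.star_det, mul_comm_of_star_eq_self h1.star_det,
    star_sum, Finset.sum_comm]
  congr 1
  refine Finset.sum_congr rfl fun y hy => ?_
  rw [star_sum]
  refine Finset.sum_congr rfl fun z hz => ?_
  rw [star_mul, star_mul, hM.apply, hM.apply, h1.star_adj z hz y hy, mul_assoc]

/-- Both sides are the `(i, l)` entry of `M * adj * M`. -/
theorem mul_minorCdet_of_erase (hM : M.IsHermitian) (IH : ∀ γ ⊂ β, CofactorRelations M γ)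
    {i l : ι} (hi : i ∈ β) (hl : l ∈ β) :
    M i l * minorCdet β M l = minorCdet β M i * M i l := by
  have hdiag : ∑ j ∈ β, M i j * minorAdj M β j i = minorCdet β M i := by
    rw [← star_minorCdet_of_erase hM IH hi, minorCdet_eq_sum M hi, star_sum]
    refine Finset.sum_congr rfl fun j hj => ?_
    rw [star_mul, hM.apply, star_minorAdj_of_erase hM IH hi hj]
  calc M i l * minorCdet β M l
      = ∑ j ∈ β, M i j * ∑ y ∈ β, minorAdj M β j y * M y l := by
        rw [Finset.sum_eq_single l, minorCdet_eq_sum M hl]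
        · intro j hj hjl
          rw [minorAdj_mul_of_erase hM IH hj hl hjl, mul_zero]
        · exact fun h => absurd hl h
    _ = ∑ y ∈ β, (∑ j ∈ β, M i j * minorAdj M β j y) * M y l := by
        simp only [Finset.mul_sum, Finset.sum_mul, mul_assoc]
        exact Finset.sum_comm
    _ = minorCdet β M i * M i l := by
        rw [Finset.sum_eq_single i, hdiag]
        · intro y hy hyi
          rw [mul_minorAdj_of_erase hM IH hi hy (Ne.symm hyi), zero_mul]
        · exact fun h => absurd hi h

theorem continuous_minorCdet (β : Finset ι) (j : ι) :
    Continuous fun A : Matrix ι ι ℍ[ℝ] => minorCdet β A j := by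
  have hcyc : ∀ (τ : Equiv.Perm ι) (x : ι),
      Continuous fun A : Matrix ι ι ℍ[ℝ] => cycleProd A τ x := by
    intro τ x
    unfold cycleProd
    refine continuous_list_prod _ fun s _ => ?_
    exact continuous_id.matrix_elem _ _
  unfold minorCdet
  refine continuous_finsetSum _ fun τ _ => continuous_const.mul (Continuous.mul ?_ (hcyc τ j))
  exact continuous_list_prod _ fun x _ => hcyc τ x

/-- All column determinants of a Hermitian matrix agree. If the entry at `(i, l)` is nonzero, this
follows from `mul_minorCdet_of_erase`; otherwise that entry is perturbed by a real number
`t → 0`. -/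
theorem minorCdet_eq_of_erase
    (IH : ∀ γ ⊂ β, ∀ M : Matrix ι ι ℍ[ℝ], M.IsHermitian → CofactorRelations M γ)
    (hM : M.IsHermitian) {i l : ι} (hi : i ∈ β) (hl : l ∈ β) :
    minorCdet β M i = minorCdet β M l := by
  have key : ∀ N : Matrix ι ι ℍ[ℝ], N.IsHermitian → N i l ≠ 0 →
      minorCdet β N i = minorCdet β N l := by
    intro N hN h0
    have IHN : ∀ γ ⊂ β, CofactorRelations N γ := fun γ hγ => IH γ hγ N hN
    have h := mul_minorCdet_of_erase hN IHN hi hl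
    rw [mul_comm_of_star_eq_self (star_minorCdet_of_erase hN IHN hi)] at h
    exact (mul_left_cancel₀ h0 h).symm
  by_cases hil : i = l
  · rw [hil]
  by_cases h0 : M i l = 0
  · let E : Matrix ι ι ℍ[ℝ] := Matrix.single i l 1 + Matrix.single l i 1
    have hE : E.IsHermitian := by
      simp [E, Matrix.IsHermitian, Matrix.conjTranspose_add, Matrix.conjTranspose_single, add_comm]
    have hN : ∀ t : ℝ, (M + t • E).IsHermitian := fun t => by
      refine Matrix.IsHermitian.ext fun a b => ?_
      rw [Matrix.add_apply, Matrix.add_apply, Matrix.smul_apply, Matrix.smul_apply, star_add,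
        Quaternion.star_smul, hM.apply, hE.apply]
    have hc : Continuous fun t : ℝ => M + t • E := by fun_prop
    have hcl : ∀ j, Continuous fun t : ℝ => minorCdet β (M + t • E) j :=
      fun j => (continuous_minorCdet β j).comp hc
    have heq : (fun t : ℝ => minorCdet β (M + t • E) i) = fun t => minorCdet β (M + t • E) l := by
      refine Continuous.ext_on (dense_compl_singleton (0 : ℝ)) (hcl i) (hcl l) fun t ht => ?_
      refine key _ (hN t) ?_
      have : (M + t • E) i l = (t : ℍ[ℝ]) := by
        have hEil : E i l = 1 := by
          change (Matrix.single i l 1 + Matrix.single l i 1 : Matrix ι ι ℍ[ℝ]) i l = 1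
          rw [Matrix.add_apply, Matrix.single_apply_same,
            Matrix.single_apply_of_ne (h := fun h => hil h.1.symm), add_zero]
        rw [Matrix.add_apply, h0, zero_add, Matrix.smul_apply, hEil,
          ← Quaternion.coe_mul_eq_smul, mul_one]
      rw [this]
      exact fun h => ht (Quaternion.coe_injective h)
    simpa using congrFun heq 0
  · exact key M hM h0

theorem cofactorRelations (hM : M.IsHermitian) (β : Finset ι) : CofactorRelations M β := by
  induction β using Finset.strongInduction generalizing M with
  | H β IH =>
    have IHM : ∀ γ ⊂ β, CofactorRelations M γ := fun γ hγ => IH γ hγ hM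
    have hdet : ∀ i ∈ β, minorDet β M = minorCdet β M i := by
      intro i hi
      rw [minorDet_eq_minorCdet M (β.min'_mem ⟨i, hi⟩) fun x hx => β.min'_le x hx]
      exact minorCdet_eq_of_erase (fun γ hγ N hN => IH γ hγ hN) hM (β.min'_mem ⟨i, hi⟩) hi
    refine ⟨?_, fun i hi l hl => star_minorAdj_of_erase hM IHM hi hl, fun i hi j hj => ?_⟩
    · rcases β.eq_empty_or_nonempty with rfl | ⟨i, hi⟩
      · simp
      · rw [hdet i hi]
        exact star_minorCdet_of_erase hM IHM hi
    · split_ifs with hij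
      · subst hij
        rw [hdet i hi, minorCdet_eq_sum M hi]
      · exact minorAdj_mul_of_erase hM IHM hi hj hij

end Hermitian

/-! ### Sums of principal minors and of their adjugates -/

section Faddeev

theorem re_finsetSum {α : Type*} (s : Finset α) (f : α → ℍ[ℝ]) :
    (∑ a ∈ s, f a).re = ∑ a ∈ s, (f a).re :=
  map_sum (show ℍ[ℝ] →ₗ[ℝ] ℝ from QuaternionAlgebra.reₗ _ _ _) f s

variable {ι : Type*} [Fintype ι] [LinearOrder ι]

/-- The sum of the principal minors of order `m` of a Hermitian matrix, as a real number. -/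
noncomputable def minorSum (M : Matrix ι ι ℍ[ℝ]) (m : ℕ) : ℝ :=
  ∑ β ∈ Finset.univ.powersetCard m, (minorDet β M).re

/-- The sum of the adjugates of the principal submatrices of order `m`, extended by zero to the
whole index set. -/
noncomputable def adjSum (M : Matrix ι ι ℍ[ℝ]) (m : ℕ) : Matrix ι ι ℍ[ℝ] :=
  Matrix.of fun i l =>
    ∑ β ∈ Finset.univ.powersetCard m with i ∈ β ∧ l ∈ β, minorAdj M β i l

theorem adjSum_apply (M : Matrix ι ι ℍ[ℝ]) (m : ℕ) (i l : ι) : adjSum M m i l =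
    ∑ β ∈ Finset.univ.powersetCard m with i ∈ β ∧ l ∈ β, minorAdj M β i l := rfl

theorem sum_adjSum_mul (M : Matrix ι ι ℍ[ℝ]) (m : ℕ) (i : ι) (c : ι → ℍ[ℝ]) :
    ∑ l, adjSum M m i l * c l =
      ∑ β ∈ Finset.univ.powersetCard m with i ∈ β, minorCdet β (M.updateCol i c) i := by
  simp only [adjSum_apply, Finset.sum_mul]
  rw [Finset.sum_comm' (t' := {β ∈ Finset.univ.powersetCard m | i ∈ β}) (s' := fun β => β)]
  · refine Finset.sum_congr rfl fun β hβ => ?_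
    rw [minorCdet_updateCol M (Finset.mem_filter.1 hβ).2]
  · intro x y
    simp only [Finset.mem_univ, true_and, Finset.mem_filter]
    tauto

variable {M : Matrix ι ι ℍ[ℝ]}

theorem minorDet_eq_coe (hM : M.IsHermitian) (β : Finset ι) :
    minorDet β M = ((minorDet β M).re : ℍ[ℝ]) :=
  Quaternion.star_eq_self.1 (cofactorRelations hM β).star_det

theorem coe_minorSum (hM : M.IsHermitian) (m : ℕ) :
    (minorSum M m : ℍ[ℝ]) = ∑ β ∈ Finset.univ.powersetCard m, minorDet β M := by
  rw [minorSum, ← Quaternion.algebraMap_def, map_sum]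
  refine Finset.sum_congr rfl fun β _ => ?_
  rw [Quaternion.algebraMap_def, ← minorDet_eq_coe hM]

theorem adjSum_succ_self (M : Matrix ι ι ℍ[ℝ]) (m : ℕ) (i : ι) :
    adjSum M (m + 1) i i = ∑ β ∈ Finset.univ.powersetCard m with i ∉ β, minorDet β M := by
  rw [adjSum_apply]
  refine Finset.sum_bij' (fun β _ => β.erase i) (fun β _ => insert i β) ?_ ?_ ?_ ?_ ?_
  · intro β hβ
    simp only [Finset.mem_filter, Finset.mem_powersetCard_univ, and_self] at hβ ⊢
    exact ⟨by rw [Finset.card_erase_of_mem hβ.2, hβ.1]; rfl, Finset.notMem_erase i β⟩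
  · intro β hβ
    simp only [Finset.mem_filter, Finset.mem_powersetCard_univ, and_self] at hβ ⊢
    exact ⟨by rw [Finset.card_insert_of_notMem hβ.2, hβ.1], Finset.mem_insert_self i β⟩
  · intro β hβ
    exact Finset.insert_erase (Finset.mem_filter.1 hβ).2.1
  · intro β hβ
    exact Finset.erase_insert (Finset.mem_filter.1 hβ).2
  · intro β _
    exact minorAdj_self M β i

theorem adjSum_succ_of_ne (M : Matrix ι ι ℍ[ℝ]) (m : ℕ) {i j : ι} (hij : i ≠ j) :
    adjSum M (m + 1) i j = - ∑ β ∈ Finset.univ.powersetCard m with i ∈ β ∧ j ∉ β,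
      minorCdet β (M.updateCol i (M.col j)) i := by
  rw [adjSum_apply, ← Finset.sum_neg_distrib]
  refine Finset.sum_bij' (fun β _ => β.erase j) (fun β _ => insert j β) ?_ ?_ ?_ ?_ ?_
  · intro β hβ
    simp only [Finset.mem_filter, Finset.mem_powersetCard_univ] at hβ ⊢
    exact ⟨by rw [Finset.card_erase_of_mem hβ.2.2, hβ.1]; rfl,
      Finset.mem_erase.2 ⟨hij, hβ.2.1⟩, Finset.notMem_erase j β⟩
  · intro β hβ
    simp only [Finset.mem_filter, Finset.mem_powersetCard_univ] at hβ ⊢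
    exact ⟨by rw [Finset.card_insert_of_notMem hβ.2.2, hβ.1], Finset.mem_insert_of_mem hβ.2.1,
      Finset.mem_insert_self j β⟩
  · intro β hβ
    exact Finset.insert_erase (Finset.mem_filter.1 hβ).2.2
  · intro β hβ
    exact Finset.erase_insert (Finset.mem_filter.1 hβ).2.2
  · intro β _
    rw [minorAdj, if_neg hij.symm]

/-- The Faddeev–LeVerrier recursion. In `adjSum M m * M`, the sets `β` that contain `j` contribute
the diagonal by the cofactor relations, and the others contribute adjugate entries of order
`m + 1` by the definition of `minorAdj`. -/
theorem adjSum_succ (hM : M.IsHermitian) (m : ℕ) :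
    adjSum M (m + 1) = minorSum M m • (1 : Matrix ι ι ℍ[ℝ]) - adjSum M m * M := by
  rw [eq_sub_iff_add_eq]
  ext1 i j
  rw [Matrix.add_apply, Matrix.mul_apply, sum_adjSum_mul M m i (fun l => M l j), Matrix.smul_apply]
  have hcd : ∀ β : Finset ι, i ∈ β → j ∈ β → minorCdet β (M.updateCol i (fun l => M l j)) i =
      if i = j then minorDet β M else 0 := by
    intro β hi hj
    rw [minorCdet_updateCol M hi, (cofactorRelations hM β).adj_mul i hi j hj]
  by_cases hij : i = j
  · subst hij
    rw [Matrix.one_apply_eq, ← Quaternion.coe_mul_eq_smul, mul_one, coe_minorSum hM,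
      adjSum_succ_self,
      ← Finset.sum_filter_not_add_sum_filter (Finset.univ.powersetCard m) (fun β => i ∈ β)]
    congr 1
    refine Finset.sum_congr rfl fun β hβ => ?_
    have hi := (Finset.mem_filter.1 hβ).2
    rw [hcd β hi hi, if_pos rfl]
  · rw [Matrix.one_apply_ne hij, smul_zero, adjSum_succ_of_ne M m hij, neg_add_eq_zero, eq_comm,
      ← Finset.sum_filter_add_sum_filter_not _ (fun β => j ∈ β), Finset.filter_filter,
      Finset.filter_filter]
    rw [Finset.sum_eq_zero, zero_add]
    · rfl
    · intro β hβ
      have h := (Finset.mem_filter.1 hβ).2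
      rw [hcd β h.1 h.2, if_neg hij]

theorem adjSum_zero (M : Matrix ι ι ℍ[ℝ]) : adjSum M 0 = 0 := by
  ext1 i l
  rw [adjSum_apply, Matrix.zero_apply]
  refine Finset.sum_eq_zero fun β hβ => ?_
  simp only [Finset.mem_filter, Finset.mem_powersetCard_univ, Finset.card_eq_zero] at hβ
  rw [hβ.1] at hβ
  exact absurd hβ.2.1 (Finset.notMem_empty i)

theorem adjSum_eq_zero_of_card_lt (M : Matrix ι ι ℍ[ℝ]) {m : ℕ} (hm : Fintype.card ι < m) :
    adjSum M m = 0 := by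
  ext1 i l
  rw [adjSum_apply, Finset.powersetCard_eq_empty.2 (by rwa [Finset.card_univ])]
  rfl

theorem minorSum_zero (M : Matrix ι ι ℍ[ℝ]) : minorSum M 0 = 1 := by
  simp [minorSum]

theorem trace_adjSum_succ (M : Matrix ι ι ℍ[ℝ]) (m : ℕ) :
    (adjSum M (m + 1)).trace.re = (Fintype.card ι - m : ℕ) * minorSum M m := by
  have h : (adjSum M (m + 1)).trace =
      ∑ β ∈ Finset.univ.powersetCard m, (Fintype.card ι - m : ℕ) • minorDet β M := by
    simp only [Matrix.trace, Matrix.diag_apply, adjSum_succ_self]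
    rw [Finset.sum_comm' (t' := Finset.univ.powersetCard m) (s' := fun β => βᶜ)]
    · refine Finset.sum_congr rfl fun β hβ => ?_
      rw [Finset.sum_const, Finset.card_compl, (Finset.mem_powersetCard.1 hβ).2]
    · intro x y
      simp only [Finset.mem_univ, true_and, Finset.mem_filter, Finset.mem_compl]
      tauto
  rw [h, minorSum, Finset.mul_sum, re_finsetSum]
  refine Finset.sum_congr rfl fun β _ => ?_
  rw [← Nat.cast_smul_eq_nsmul ℝ, Quaternion.re_smul, smul_eq_mul]

theorem commute_adjSum (hM : M.IsHermitian) {B : Matrix ι ι ℍ[ℝ]} (hB : Commute B M) (m : ℕ) :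
    Commute B (adjSum M m) := by
  induction m with
  | zero => rw [adjSum_zero]; exact Commute.zero_right B
  | succ m ih =>
    rw [adjSum_succ hM]
    exact ((Commute.one_right B).smul_right _).sub_right (ih.mul_right hB)

/-- If `X * M * M = 0`, the rows of `X * M` have norm zero. -/
theorem mul_eq_zero_of_mul_mul_self_eq_zero {n : Type*} [Fintype n] {M X : Matrix n n ℍ[ℝ]}
    (hM : M.IsHermitian)
    (h : X * M * M = 0) : X * M = 0 := by
  have h1 : X * M * (X * M).conjTranspose = 0 := by
    rw [Matrix.conjTranspose_mul, hM.eq, ← Matrix.mul_assoc, h, Matrix.zero_mul]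
  ext1 i j
  have h2 := congrFun (congrFun h1 i) i
  rw [Matrix.mul_apply] at h2
  have h3 : ∑ l, Quaternion.normSq ((X * M) i l) = 0 := by
    apply Quaternion.coe_injective
    rw [← Quaternion.algebraMap_def, map_sum, map_zero]
    rw [← show _ = (0 : ℍ[ℝ]) from h2]
    refine Finset.sum_congr rfl fun l _ => ?_
    rw [Matrix.conjTranspose_apply, Quaternion.algebraMap_def, Quaternion.self_mul_star]
  rw [Finset.sum_eq_zero_iff_of_nonneg fun _ _ => Quaternion.normSq_nonneg] at h3
  exact Quaternion.normSq_eq_zero.1 (h3 j (Finset.mem_univ j))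

theorem mul_eq_zero_of_mul_pow_eq_zero (hM : M.IsHermitian) {X : Matrix ι ι ℍ[ℝ]} {q : ℕ}
    (h : X * M ^ q = 0) : X * M = 0 := by
  induction q with
  | zero => rw [pow_zero, mul_one] at h; rw [h, zero_mul]
  | succ q ih =>
    rcases q with _ | q
    · rwa [zero_add, pow_one] at h
    · apply ih
      rw [pow_succ, ← mul_assoc]
      apply mul_eq_zero_of_mul_mul_self_eq_zero hM
      rw [mul_assoc, mul_assoc, ← mul_assoc (M ^ q), ← pow_succ, ← pow_succ, h]

theorem exists_last_minorSum (M : Matrix ι ι ℍ[ℝ]) :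
    ∃ s ≤ Fintype.card ι, minorSum M s ≠ 0 ∧ ∀ m, s < m → minorSum M m = 0 := by
  classical
  have h0 : minorSum M 0 ≠ 0 := by rw [minorSum_zero]; exact one_ne_zero
  refine ⟨Nat.findGreatest (fun m => minorSum M m ≠ 0) (Fintype.card ι), Nat.findGreatest_le _,
    Nat.findGreatest_spec (P := fun m => minorSum M m ≠ 0) (Nat.zero_le _) h0, fun m hm => ?_⟩
  by_cases hmn : m ≤ Fintype.card ι
  · by_contra hne
    exact Nat.findGreatest_is_greatest hm hmn hne
  · rw [minorSum, Finset.powersetCard_eq_empty.2 (by rw [Finset.card_univ]; omega),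
      Finset.sum_empty]

/-- If `s` is the order of the last nonvanishing sum of principal minors, then `adjSum M (s + 1)`
annihilates `M`: each later `adjSum` is the preceding one times `-M`, and they vanish beyond the
size of `M`. -/
theorem adjSum_succ_mul (hM : M.IsHermitian) {s : ℕ} (hs : ∀ m, s < m → minorSum M m = 0) :
    adjSum M (s + 1) * M = 0 := by
  have hpow : ∀ q, adjSum M (s + 1 + q) = (-1 : ℝ) ^ q • (adjSum M (s + 1) * M ^ q) := by
    intro q
    induction q with
    | zero => simp
    | succ q ih =>
      rw [← add_assoc, adjSum_succ hM, hs _ (by omega), zero_smul, zero_sub, ih, Matrix.smul_mul,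
        mul_assoc, ← pow_succ, pow_succ (-1 : ℝ), mul_neg_one, neg_smul]
  have h := hpow (Fintype.card ι)
  rw [adjSum_eq_zero_of_card_lt M (by omega), eq_comm, smul_eq_zero] at h
  exact mul_eq_zero_of_mul_pow_eq_zero hM (h.resolve_left (by simp))

end Faddeev

/-! ### Column rank and idempotents -/

section ColRank

variable {m n p : Type*}

/-- The right span of the columns of a matrix. -/
def colSpace {m n R : Type*} [Ring R] (A : Matrix m n R) : Submodule Rᵐᵒᵖ (m → R) :=
  Submodule.span Rᵐᵒᵖ (Set.range A.col)

theorem colRank_eq_finrank {m n R : Type*} [Ring R] (A : Matrix m n R) :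
    colRank A = Module.finrank Rᵐᵒᵖ (colSpace A) := rfl

theorem mulVec_mem_colSpace [Fintype n] {R : Type*} [Ring R] (A : Matrix m n R) (v : n → R) :
    A.mulVec v ∈ colSpace A := by
  have : A.mulVec v = ∑ j, MulOpposite.op (v j) • A.col j := by
    ext i
    simp [Matrix.mulVec, dotProduct, Finset.sum_apply]
  rw [this]
  exact Submodule.sum_mem _ fun j _ => Submodule.smul_mem _ _ (Submodule.subset_span ⟨j, rfl⟩)

theorem colSpace_mul_le [Fintype n] {R : Type*} [Ring R] (A : Matrix m n R) (B : Matrix n p R) :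
    colSpace (A * B) ≤ colSpace A := by
  rw [colSpace, Submodule.span_le]
  rintro _ ⟨j, rfl⟩
  exact mulVec_mem_colSpace A (B.col j)

instance finite_colSpace [Finite n] {K : Type*} [DivisionRing K] (A : Matrix m n K) :
    Module.Finite Kᵐᵒᵖ (colSpace A) :=
  FiniteDimensional.span_of_finite _ (Set.finite_range _)

theorem exists_eq_mul_of_forall_mem_colSpace [Fintype p] {R : Type*} [Ring R]
    {A : Matrix m n R} {B : Matrix m p R} (h : ∀ j, A.col j ∈ colSpace B) :
    ∃ Y : Matrix p n R, A = B * Y := by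
  have h' := fun j => (Submodule.mem_span_range_iff_exists_fun _).1 (h j)
  choose c hc using h'
  refine ⟨Matrix.of fun a j => (c j a).unop, ?_⟩
  ext i j
  have := congrFun (hc j) i
  simp only [Finset.sum_apply, Pi.smul_apply] at this
  rw [Matrix.mul_apply]
  exact this.symm

theorem exists_mul_mul_eq_of_colRank_eq [Fintype n] {K : Type*} [DivisionRing K] (A : Matrix m n K)
    (B : Matrix n n K) (h : colRank (A * B) = colRank A) : ∃ Y : Matrix n n K, A = A * B * Y := by
  have e : colSpace (A * B) = colSpace A :=
    Submodule.eq_of_le_of_finrank_eq (colSpace_mul_le A B) h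
  refine exists_eq_mul_of_forall_mem_colSpace fun j => ?_
  rw [e]
  exact Submodule.subset_span ⟨j, rfl⟩

/-- The rank of an idempotent quaternion matrix `Q` is the real part of its trace: if the columns
of `U` are a basis of the column space and `Q = U * V`, then `V * U = 1`. -/
theorem trace_re_eq_colRank [Fintype n] {Q : Matrix n n ℍ[ℝ]} (hQ : Q * Q = Q) :
    Q.trace.re = colRank Q := by
  classical
  let b := Module.finBasis ℍ[ℝ]ᵐᵒᵖ (colSpace Q)
  let U : Matrix n (Fin (Module.finrank ℍ[ℝ]ᵐᵒᵖ (colSpace Q))) ℍ[ℝ] :=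
    Matrix.of fun i a => (b a).1 i
  obtain ⟨V, hV⟩ : ∃ V : Matrix (Fin (Module.finrank ℍ[ℝ]ᵐᵒᵖ (colSpace Q))) n ℍ[ℝ],
      Q = U * V := by
    have hspan : colSpace U = colSpace Q := by
      have h1 := congrArg (Submodule.map (colSpace Q).subtype) b.span_eq
      rw [Submodule.map_span, ← Set.range_comp, Submodule.map_top, Submodule.range_subtype] at h1
      exact h1
    refine exists_eq_mul_of_forall_mem_colSpace fun j => ?_
    rw [hspan]
    exact Submodule.subset_span ⟨j, rfl⟩
  have hQU : Q * U = U := by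
    obtain ⟨W, hW⟩ : ∃ W : Matrix n (Fin (Module.finrank ℍ[ℝ]ᵐᵒᵖ (colSpace Q))) ℍ[ℝ],
        U = Q * W :=
      exists_eq_mul_of_forall_mem_colSpace fun a => (b a).2
    rw [hW, ← Matrix.mul_assoc, hQ]
  have hinj : ∀ Z : Matrix (Fin (Module.finrank ℍ[ℝ]ᵐᵒᵖ (colSpace Q)))
      (Fin (Module.finrank ℍ[ℝ]ᵐᵒᵖ (colSpace Q))) ℍ[ℝ], U * Z = 0 → Z = 0 := by
    intro Z hZ
    ext1 a c
    have hsum : ∑ d, MulOpposite.op (Z d c) • b d = 0 := by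
      refine Subtype.ext (funext fun i => ?_)
      have := congrFun (congrFun hZ i) c
      rw [Matrix.mul_apply] at this
      rw [AddSubmonoidClass.coe_finsetSum, Finset.sum_apply]
      exact this
    have := Fintype.linearIndependent_iff.1 b.linearIndependent _ hsum a
    simpa using this
  have hVU : V * U = 1 := by
    rw [← sub_eq_zero]
    apply hinj
    rw [Matrix.mul_sub, ← Matrix.mul_assoc, ← hV, hQU, Matrix.mul_one, sub_self]
  have htr : (U * V).trace.re = (V * U).trace.re := by
    simp only [Matrix.trace, Matrix.diag_apply, Matrix.mul_apply]
    simp only [re_finsetSum]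
    rw [Finset.sum_comm]
    refine Finset.sum_congr rfl fun a _ => Finset.sum_congr rfl fun i _ => ?_
    simp only [Quaternion.re_mul]
    ring
  rw [hV, htr, hVU, ← hV, Matrix.trace_one, colRank_eq_finrank, Fintype.card_fin]
  simp

end ColRank

/-! ### The Drazin inverse -/

section Drazin

variable {ι : Type*} [Fintype ι] [LinearOrder ι] {M : Matrix ι ι ℍ[ℝ]}

/-- For a Hermitian matrix of rank `r`, the sum of the principal minors of order `r` is nonzero, and
the adjugate sum of order `r`, divided by it, inverts `M` on the column space of `M`. -/
theorem minorSum_ne_zero_and_adjSum_mul_mul (hM : M.IsHermitian) :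
    minorSum M (colRank M) ≠ 0 ∧
      adjSum M (colRank M) * M * M = minorSum M (colRank M) • M := by
  obtain ⟨s, hs, hne, hlast⟩ := exists_last_minorSum M
  have hmul : adjSum M s * M * M = minorSum M s • M := by
    have h := adjSum_succ_mul hM hlast
    rw [adjSum_succ hM, Matrix.sub_mul, Matrix.smul_mul, Matrix.one_mul, sub_eq_zero] at h
    exact h.symm
  suffices hsr : colRank M = s by
    rw [hsr]
    exact ⟨hne, hmul⟩
  set Q : Matrix ι ι ℍ[ℝ] := (minorSum M s)⁻¹ • (adjSum M s * M) with hQdef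
  have hQM : Q * M = M := by
    rw [hQdef, Matrix.smul_mul, hmul, smul_smul, inv_mul_cancel₀ hne, one_smul]
  have hcomm : adjSum M s * M = M * adjSum M s := (commute_adjSum hM (Commute.refl M) s).symm
  have hQ' : Q = M * ((minorSum M s)⁻¹ • adjSum M s) := by
    rw [hQdef, hcomm, Matrix.mul_smul]
  have hQQ : Q * Q = Q := by
    calc Q * Q = Q * (M * ((minorSum M s)⁻¹ • adjSum M s)) := by rw [← hQ']
      _ = Q := by rw [← Matrix.mul_assoc, hQM, ← hQ']
  have hspace : colSpace Q = colSpace M := by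
    apply le_antisymm
    · rw [hQ']
      exact colSpace_mul_le _ _
    · have h := colSpace_mul_le Q M
      rwa [hQM] at h
  -- The trace of `Q` is the rank of `M`; by the trace of `adjSum M (s + 1)` it is also `s`.
  have htr := trace_re_eq_colRank hQQ
  have hQ1 : Q = 1 - (minorSum M s)⁻¹ • adjSum M (s + 1) := by
    rw [adjSum_succ hM, smul_sub, smul_smul, inv_mul_cancel₀ hne, one_smul, sub_sub_cancel]
  rw [colRank_eq_finrank, hspace, ← colRank_eq_finrank, hQ1, Matrix.trace_sub, Matrix.trace_smul,
    Quaternion.re_sub, Quaternion.re_smul, trace_adjSum_succ, Matrix.trace_one, Nat.cast_sub hs,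
    smul_eq_mul, mul_comm _ (minorSum M s), inv_mul_cancel_left₀ hne] at htr
  have : (s : ℝ) = colRank M := by
    rw [← htr]
    simp
  exact_mod_cast this.symm

theorem sumPrincipalMinors_eq (hM : M.IsHermitian) (r : ℕ) :
    sumPrincipalMinors r M = (minorSum M r : ℍ[ℝ]) := by
  rw [coe_minorSum hM, sumPrincipalMinors]
  simp only [hermDet_principalSubmatrix]
  exact (Finset.sum_subtype _ (fun β => Finset.mem_powersetCard_univ) fun β => minorDet β M).symm

theorem sumPrincipalCdet_updateCol (M : Matrix ι ι ℍ[ℝ]) (r : ℕ) (i : ι) (c : ι → ℍ[ℝ]) :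
    sumPrincipalCdet r (M.updateCol i c) i = ∑ l, adjSum M r i l * c l := by
  rw [sum_adjSum_mul, sumPrincipalCdet]
  simp only [cdet_principalSubmatrix]
  exact (Finset.sum_subtype _ (fun β => by simp) fun β => minorCdet β (M.updateCol i c) i).symm

theorem pow_succ_mul_pow_of_mul_mul_self {S : Type*} [Monoid S] {a x : S} (hx : x * a * x = x)
    (hc : a * x = x * a) (k : ℕ) : x ^ (k + 1) * a ^ k = x := by
  induction k with
  | zero => simp
  | succ k ih =>
    rw [pow_succ' x, pow_succ a, mul_assoc, ← mul_assoc (x ^ (k + 1)), ih, ← hc, ← mul_assoc, hx]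

/-- Uniqueness of the Drazin inverse in a monoid: both `x` and `y` equal `x * a * y`. -/
theorem drazin_unique {S : Type*} [Monoid S] {a x y : S} {k : ℕ} (hx : a ^ (k + 1) * x = a ^ k)
    (hx2 : x * a * x = x) (hxc : a * x = x * a) (hy : a ^ (k + 1) * y = a ^ k)
    (hy2 : y * a * y = y) (hyc : a * y = y * a) : x = y := by
  have key : ∀ {u v : S}, u * a * u = u → a * u = u * a → a ^ (k + 1) * v = a ^ k →
      u = u * a * v := by
    intro u v hu huc hv
    have h := pow_succ_mul_pow_of_mul_mul_self hu huc k
    calc u = u ^ (k + 1) * a ^ k := h.symm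
      _ = u ^ (k + 1) * a ^ k * a * v := by
          rw [mul_assoc (u ^ (k + 1)), ← pow_succ, mul_assoc _ (a ^ (k + 1)), hv]
      _ = u * a * v := by rw [h]
  have hxy : a ^ k = x * a * a ^ k := by
    rw [mul_assoc, ← pow_succ', ← (show Commute a x from hxc).pow_left (k + 1), hx]
  have hy' : a ^ k * y ^ (k + 1) = y := by
    rw [((show Commute a y from hyc).pow_pow k (k + 1)).eq,
      pow_succ_mul_pow_of_mul_mul_self hy2 hyc]
  calc x = x * a * y := key hx2 hxc hy
    _ = x * a * a ^ k * y ^ (k + 1) := by rw [mul_assoc _ (a ^ k), hy']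
    _ = y := by rw [← hxy, hy']

end Drazin

/-- If `M = A ^ (k + 1)` has the same rank `r` as `A ^ k`, the matrix `adjSum M r * A ^ k`, divided
by the sum of the principal minors of order `r`, satisfies the equations of the Drazin inverse. -/
theorem drazin_equations {ι : Type*} [Fintype ι] [LinearOrder ι] {A : Matrix ι ι ℍ[ℝ]}
    (hA : A.IsHermitian) {k : ℕ} (hk : colRank (A ^ (k + 1)) = colRank (A ^ k))
    {X : Matrix ι ι ℍ[ℝ]}
    (hX : X = (minorSum (A ^ (k + 1)) (colRank (A ^ (k + 1))))⁻¹ •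
      adjSum (A ^ (k + 1)) (colRank (A ^ (k + 1))) * A ^ k) :
    A ^ (k + 1) * X = A ^ k ∧ X * A * X = X ∧ A * X = X * A := by
  have hM : (A ^ (k + 1)).IsHermitian := hA.pow _
  obtain ⟨hne, hmul⟩ := minorSum_ne_zero_and_adjSum_mul_mul hM
  set F := (minorSum (A ^ (k + 1)) (colRank (A ^ (k + 1))))⁻¹ •
      adjSum (A ^ (k + 1)) (colRank (A ^ (k + 1))) with hF
  have hcomm : Commute A F :=
    (commute_adjSum hM (Commute.self_pow A (k + 1)) _).smul_right _
  have hFM : F * A ^ (k + 1) * A ^ (k + 1) = A ^ (k + 1) := by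
    rw [hF, Matrix.smul_mul, Matrix.smul_mul, hmul, smul_smul, inv_mul_cancel₀ hne, one_smul]
  -- By the equality of ranks the columns of `A ^ k` lie in the column space of `A ^ (k + 1)`.
  have hFk : F * A ^ (k + 1) * A ^ k = A ^ k := by
    obtain ⟨Y, hY⟩ := exists_mul_mul_eq_of_colRank_eq (A ^ k) A (by rw [← pow_succ, hk])
    rw [← pow_succ] at hY
    rw [hY, ← Matrix.mul_assoc, hFM]
  refine ⟨?_, ?_, ?_⟩
  · rw [hX, ← mul_assoc, (hcomm.pow_left (k + 1)).eq, hFk]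
  · calc X * A * X = F * (F * A ^ (k + 1) * A ^ k) := by
          rw [hX, mul_assoc F, ← pow_succ, ← mul_assoc (F * A ^ (k + 1)), mul_assoc F (A ^ (k + 1)),
            (hcomm.pow_left (k + 1)).eq, mul_assoc]
      _ = X := by rw [hFk, hX]
  · rw [hX, ← mul_assoc, hcomm.eq, mul_assoc, mul_assoc, ← pow_succ, ← pow_succ']

end QuatMat

theorem theorem4p1 {n m : ℕ} (A : Matrix (Fin n) (Fin n) ℍ[ℝ]) (hA : A.IsHermitian)
    (B : Matrix (Fin n) (Fin m) ℍ[ℝ]) (k r : ℕ) (hk : QuatMat.index A = k)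
    (hr_succ : QuatMat.colRank (A ^ (k + 1)) = r) (hr : QuatMat.colRank (A ^ k) = r) :
    (∃! D : Matrix (Fin n) (Fin n) ℍ[ℝ], QuatMat.IsDrazinInverse A D) ∧
    QuatMat.sumPrincipalMinors r (A ^ (k + 1)) ≠ 0 ∧
    ∀ D : Matrix (Fin n) (Fin n) ℍ[ℝ], QuatMat.IsDrazinInverse A D →
      ∀ (i : Fin n) (j : Fin m),
        (D * B) i j =
          QuatMat.sumPrincipalCdet r
              ((A ^ (k + 1)).updateCol i (fun l => (A ^ k * B) l j)) i /
            QuatMat.sumPrincipalMinors r (A ^ (k + 1)) := by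
  have hM : (A ^ (k + 1)).IsHermitian := hA.pow _
  have hne := (QuatMat.minorSum_ne_zero_and_adjSum_mul_mul hM).1
  obtain ⟨h1, h2, h3⟩ := QuatMat.drazin_equations hA (hr_succ.trans hr.symm) rfl
  rw [hr_succ] at hne h1 h2 h3
  set X : Matrix (Fin n) (Fin n) ℍ[ℝ] :=
    (QuatMat.minorSum (A ^ (k + 1)) r)⁻¹ • QuatMat.adjSum (A ^ (k + 1)) r * A ^ k with hX
  have hDX : ∀ D, QuatMat.IsDrazinInverse A D → D = X := fun D hD =>
    QuatMat.drazin_unique (hk ▸ hD.pow_succ_mul) hD.mul_mul_self hD.comm h1 h2 h3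
  refine ⟨⟨X, ⟨by rw [hk]; exact h1, h2, h3⟩, hDX⟩, ?_, fun D hD i j => ?_⟩
  · rw [QuatMat.sumPrincipalMinors_eq hM]
    exact fun h => hne (Quaternion.coe_injective h)
  · rw [hDX D hD, QuatMat.sumPrincipalMinors_eq hM, QuatMat.sumPrincipalCdet_updateCol, hX,
      Matrix.smul_mul, Matrix.smul_mul, Matrix.smul_apply, Matrix.mul_assoc, Matrix.mul_apply,
      div_eq_mul_inv, ← Quaternion.coe_inv, Quaternion.mul_coe_eq_smul]
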